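/- Let $\mathcal X$ be a set, let $S\subseteq\mathbb R$ be a Borel set with Borel $\sigma$-algebra $\mathcal B$, and for each $x\in\mathcal X$ let a probability measure on $(S,\mathcal B)$ be given, with cumulative distribution function $F_x(t)$, $t\in\mathbb R$ (the mass of $S\cap(-\infty,t]$). For every integer $d>1$ and all pairwise distinct $x_1,\dots,x_d\in\mathcal X$ let $\psi_{x_1,\dots,x_d}:[0,1]^d\to[0,1]$ be a copula, i.e. the joint cumulative distribution function of a probability measure on $[0,1]^d$ whose one-dimensional marginals are all uniform on $[0,1]$. Assume that for every $d>1$, all pairwise distinct $x_1,\dots,x_d\in\mathcal X$, all $u_1,\dots,u_d\in[0,1]$, every $k\in\{1,\dots,d\}$ and every permutation $\pi=(\pi_1,\dots,\pi_d)$ of $\{1,\dots,d\}$: (i) $\psi_{x_1,\dots,x_d}(u_1,\dots,u_d)=\psi_{x_{\pi_1},\dots,x_{\pi_d}}(u_{\pi_1},\dots,u_{\pi_d})$; (ii) $\psi_{x_1,\dots,x_d}(u_1,\dots,u_{k-1},1,u_{k+1},\dots,u_d)=\psi_{x_1,\dots,x_{k-1},x_{k+1},\dots,x_d}(u_1,\dots,u_{k-1},u_{k+1},\dots,u_d)$,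 where for $d=2$ the right-hand side is read with $\psi_x(u)=u$ (so that this case holds automatically for copulas). Then there exist a probability space $(\Omega,\mathcal F,P)$ and a stochastic process $Y:\mathcal X\times\Omega\to S$ (each $Y(x,\cdot)$ is measurable) such that for every $d>1$, all pairwise distinct $x_1,\dots,x_d\in\mathcal X$ and all $t_1,\dots,t_d\in\mathbb R$, $$P\{\omega\in\Omega: Y(x_1,\omega)\le t_1,\dots,Y(x_d,\omega)\le t_d\}=\psi_{x_1,\dots,x_d}\big(F_{x_1}(t_1),\dots,F_{x_d}(t_d)\big),$$ and, for all $x\in\mathcal X$ and $t\in\mathbb R$, $P\{\omega\in\Omega: Y(x,\omega)\le t\}=F_x(t)$. -/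

import Mathlib

open MeasureTheory
open scoped unitInterval

universe u

/-- A `d`-dimensional copula: the joint cumulative distribution function, on the unit cube
`[0,1]^d`, of a probability measure all of whose one-dimensional marginals are uniform on `[0,1]`.
Here `Set.Iic u` is the box `{v | v i ≤ u i for all i}`, and `volume` on `I = [0,1]` is
Lebesgue measure. -/
def IsCopula {d : ℕ} (C : (Fin d → I) → I) : Prop :=
  ∃ μ : Measure (Fin d → I), IsProbabilityMeasure μ ∧
    (∀ i, μ.map (fun v => v i) = volume) ∧
    ∀ u, μ.real (Set.Iic u) = (C u : ℝ)

/-- The cumulative distribution function `t ↦ μ {s ∈ S | s ≤ t}`, `t ∈ ℝ`, of a probability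
measure `μ` on the Borel sets of `S ⊆ ℝ`. Its values lie in `[0,1]`. -/
noncomputable def distFun {S : Set ℝ} (μ : Measure S) [IsProbabilityMeasure μ] (t : ℝ) : I :=
  ⟨μ.real {s : S | (s : ℝ) ≤ t}, measureReal_nonneg, measureReal_le_one⟩

/-!
The process is built in two stages: first a process `U` indexed by `X` whose
finite-dimensional distributions are the copulas `ψ`, then `Y x = q x (U x)`, where `q x` is the
quantile function of `F x`. Since `q x u ≤ t` holds exactly when `u ≤ F x t`, up to a null set
of `u`, and each `U x` is uniform, the joint distribution function of the `Y x` is the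
copula evaluated at the marginal distribution functions.

To build `U`, the copula measures are transported to the finite subsets `J` of `X`. Symmetry of `ψ`
makes the measure on `J → I` independent of the enumeration of `J`, and the marginal condition
makes these measures a projective family (`isProjectiveMeasureFamily_of_copula`), since a
probability measure on a finite power of `I` is determined by the boxes `Set.Iic u`
(`ext_of_Iic_pi`). The family has a projective limit by Kolmogorov's extension theorem, proved here
for compact metrizable fibres (`exists_isProjectiveLimit`): there cylinders are approximated from
inside by closed, hence compact, cylinders, and the finite intersection property gives continuity
of the cylinder content at `∅`.
-/

open Filter Set
open scoped Topology ENNReal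

/-! ### Kolmogorov extension over compact metrizable spaces -/

section Kolmogorov

variable {ι : Type*} {α : ι → Type*} [∀ i, TopologicalSpace (α i)] [∀ i, CompactSpace (α i)]
  [∀ i, TopologicalSpace.PseudoMetrizableSpace (α i)] [∀ i, SecondCountableTopology (α i)]
  [∀ i, MeasurableSpace (α i)] [∀ i, BorelSpace (α i)]
  {P : ∀ J : Finset ι, Measure (∀ j : J, α j)} [∀ J, IsFiniteMeasure (P J)]

theorem projectiveFamilyContent_tendsto_zero (hP : IsProjectiveMeasureFamily P)
    {A : ℕ → Set (∀ i, α i)} (hA : ∀ n, A n ∈ measurableCylinders α) (hanti : Antitone A)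
    (hinter : ⋂ n, A n = ∅) :
    Tendsto (fun n ↦ projectiveFamilyContent hP (A n)) atTop (𝓝 0) := by
  rw [ENNReal.tendsto_atTop_zero]
  intro ε hε
  obtain ⟨δ, hδ, hsum⟩ := ENNReal.exists_pos_sum_of_countable' hε.ne' ℕ
  choose J B hB hAB using fun n ↦ (mem_measurableCylinders _).1 (hA n)
  choose K hKB hK hKδ using fun n ↦
    (hB n).exists_isClosed_sdiff_lt (measure_ne_top (P (J n)) _) (hδ n).ne'
  -- the compact cylinders `cylinder (J n) (K n)` have empty intersection, hence so do finitely many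
  obtain ⟨s, hs⟩ := isCompact_univ.elim_finite_subfamily_closed
    (fun n ↦ cylinder (J n) (K n)) (fun n ↦ IsClosed.cylinder _ (hK n)) (by
      rw [univ_inter, ← subset_empty_iff, ← hinter]
      exact iInter_mono fun n ↦ by rw [hAB n]; exact preimage_mono (hKB n))
  rw [univ_inter] at hs
  refine ⟨s.sup id, fun n hn ↦ ?_⟩
  have hmem : ∀ i, cylinder (J i) (B i \ K i) ∈ measurableCylinders α := fun i ↦
    cylinder_mem_measurableCylinders _ _ ((hB i).diff (hK i).measurableSet)
  have hsub : A n ⊆ ⋃ i ∈ s, cylinder (J i) (B i \ K i) := by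
    intro ω hω
    have : ω ∉ ⋂ i ∈ s, cylinder (J i) (K i) := by rw [hs]; simp
    simp only [mem_iInter, not_forall] at this
    obtain ⟨i, hi, hiK⟩ := this
    have hωi : ω ∈ A i := hanti ((Finset.le_sup (f := id) hi).trans hn) hω
    rw [hAB i] at hωi
    exact mem_biUnion hi ⟨hωi, hiK⟩
  calc projectiveFamilyContent hP (A n)
      ≤ projectiveFamilyContent hP (⋃ i ∈ s, cylinder (J i) (B i \ K i)) :=
        projectiveFamilyContent_mono hP (hA n)
          (isSetRing_measurableCylinders.biUnion_mem s fun i _ ↦ hmem i) hsub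
    _ ≤ ∑ i ∈ s, projectiveFamilyContent hP (cylinder (J i) (B i \ K i)) :=
        addContent_biUnion_le isSetRing_measurableCylinders fun i _ ↦ hmem i
    _ ≤ ∑ i ∈ s, δ i := Finset.sum_le_sum fun i _ ↦ by
        rw [projectiveFamilyContent_cylinder hP ((hB i).diff (hK i).measurableSet)]
        exact (hKδ i).le
    _ ≤ ∑' i, δ i := ENNReal.sum_le_tsum s
    _ ≤ ε := hsum.le

/-- Kolmogorov's extension theorem, for compact metrizable fibres. -/
theorem exists_isProjectiveLimit (hP : IsProjectiveMeasureFamily P) :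
    ∃ μ : Measure (∀ i, α i), IsProjectiveLimit μ P := by
  have hsub : (projectiveFamilyContent hP).IsSigmaSubadditive :=
    isSigmaSubadditive_of_addContent_iUnion_eq_tsum isSetRing_measurableCylinders
      fun _ hf hfU hf' ↦ addContent_iUnion_eq_sum_of_tendsto_zero isSetRing_measurableCylinders
        _ (fun _ _ ↦ projectiveFamilyContent_ne_top hP)
        (fun _ ↦ projectiveFamilyContent_tendsto_zero hP) hf hfU hf'
  refine ⟨(projectiveFamilyContent hP).measure isSetSemiring_measurableCylinders
    generateFrom_measurableCylinders.ge hsub, fun J ↦ ?_⟩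
  ext s hs
  rw [Measure.map_apply (by fun_prop) hs, ← cylinder,
    AddContent.measure_eq _ _ generateFrom_measurableCylinders.symm _
      (cylinder_mem_measurableCylinders J s hs)]
  exact projectiveFamilyContent_cylinder hP hs

end Kolmogorov

/-! ### The projective family of a consistent system of copulas -/

theorem ext_of_Iic_pi {ι : Type*} [Finite ι] {μ ν : Measure (ι → I)} [IsProbabilityMeasure μ]
    [IsProbabilityMeasure ν] (h : ∀ u, μ (Iic u) = ν (Iic u)) : μ = ν := by
  have hspan : ∀ _ : ι, IsCountablySpanning (range (Iic : I → Set I)) := fun _ ↦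
    ⟨fun _ ↦ Iic 1, fun _ ↦ mem_range_self 1, by
      simp only [iUnion_const]; exact eq_univ_of_forall fun x ↦ x.2.2⟩
  refine ext_of_generate_finite (pi univ '' pi univ fun _ ↦ range Iic)
    (generateFrom_eq_pi (fun _ ↦ ?_) hspan).symm (IsPiSystem.pi fun _ ↦ isPiSystem_Iic) ?_
    (by simp)
  · rw [← borel_eq_generateFrom_Iic]; exact BorelSpace.measurable_eq.symm
  · rintro _ ⟨s, hs, rfl⟩
    choose u hu using fun i ↦ hs i (mem_univ i)
    obtain rfl : (fun i ↦ Iic (u i)) = s := funext hu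
    rw [pi_univ_Iic]
    exact h u

section Copula

variable {X : Type*}

/-- `ν` is the measure on `J → I` with uniform marginals whose distribution function is
`ψ d x`, for every enumeration `x` of `J`. The last condition is void if `J` has at most one
element. -/
structure IsCopulaMeasure (ψ : (d : ℕ) → (Fin d ↪ X) → (Fin d → I) → I) (J : Finset X)
    (ν : Measure (J → I)) : Prop where
  isProbabilityMeasure : IsProbabilityMeasure ν
  map_eval : ∀ j, ν.map (fun v ↦ v j) = volume
  real_Iic : ∀ d, 1 < d → ∀ (e : Fin d ≃ J) (u : J → I),
    ν.real (Iic u) = ψ d (e.toEmbedding.trans (Function.Embedding.subtype _)) (u ∘ e)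

variable {ψ : (d : ℕ) → (Fin d ↪ X) → (Fin d → I) → I}

theorem exists_isCopulaMeasure (hcop : ∀ d, 1 < d → ∀ x : Fin d ↪ X, IsCopula (ψ d x))
    (hperm : ∀ d, 1 < d → ∀ (x : Fin d ↪ X) (u : Fin d → I) (π : Equiv.Perm (Fin d)),
      ψ d x u = ψ d (π.toEmbedding.trans x) (fun i => u (π i))) (J : Finset X) :
    ∃ ν, IsCopulaMeasure ψ J ν := by
  by_cases hJ : 1 < J.card
  · let e := J.equivFin.symm
    obtain ⟨μ, hμ, hmap, hIic⟩ :=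
      hcop _ hJ (e.toEmbedding.trans (Function.Embedding.subtype _))
    have hm : Measurable (fun (v : Fin J.card → I) (j : J) ↦ v (e.symm j)) := by fun_prop
    refine ⟨μ.map fun v j ↦ v (e.symm j), Measure.isProbabilityMeasure_map hm.aemeasurable,
      fun j ↦ ?_, fun d hd e' u ↦ ?_⟩
    · rw [Measure.map_map (by fun_prop) hm]
      exact hmap (e.symm j)
    · obtain rfl : d = J.card := by simpa using Fintype.card_congr e'
      have hpre : (fun (v : Fin J.card → I) (j : J) ↦ v (e.symm j)) ⁻¹' Iic u = Iic (u ∘ e) := by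
        ext v
        simp only [mem_preimage, mem_Iic, Pi.le_def, Function.comp_apply]
        exact ⟨fun h i ↦ by simpa using h (e i), fun h j ↦ by simpa using h (e.symm j)⟩
      rw [map_measureReal_apply hm measurableSet_Iic, hpre, hIic,
        hperm _ hJ _ _ (e'.trans e.symm)]
      congr 2
      · ext i; simp
      · ext i; simp
  · refine ⟨Measure.pi fun _ ↦ volume, inferInstance,
      fun j ↦ (measurePreserving_eval _ j).map_eq, fun d hd e' u ↦ ?_⟩
    have : d = J.card := by simpa using Fintype.card_congr e'
    omega

/-- Removing one element `a` from the index set: for at least two remaining indices this is the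
marginal condition on `ψ`, for one it is uniformity of the marginals. -/
theorem IsCopulaMeasure.map_restrict₂_erase [DecidableEq X]
    (hmarg : ∀ d, 1 < d → ∀ (x : Fin (d + 1) ↪ X) (k : Fin (d + 1)) (u : Fin d → I),
      ψ (d + 1) x (k.insertNth (α := fun _ => I) 1 u) =
        ψ d (k.succAboveEmb.trans x) u)
    {K : Finset X} {a : X} (ha : a ∈ K) {μ : Measure (K → I)}
    {ν : Measure (K.erase a → I)} (hμ : IsCopulaMeasure ψ K μ)
    (hν : IsCopulaMeasure ψ (K.erase a) ν) :
    ν = μ.map (Finset.restrict₂ (π := fun _ ↦ I) (K.erase_subset a)) := by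
  have := hμ.isProbabilityMeasure
  have := hν.isProbabilityMeasure
  have hm : Measurable (Finset.restrict₂ (π := fun _ ↦ I) (K.erase_subset a)) :=
    Finset.measurable_restrict₂ _
  have := Measure.isProbabilityMeasure_map (μ := μ) hm.aemeasurable
  refine ext_of_Iic_pi fun u ↦ ?_
  rcases lt_trichotomy 1 (K.erase a).card with hd | hd | hd
  · rw [← measureReal_eq_measureReal_iff, map_measureReal_apply hm measurableSet_Iic]
    let e := (K.erase a).equivFin.symm
    -- the enumeration of `K` that starts with `a` and continues with `e`
    let f : Fin ((K.erase a).card + 1) → K :=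
      Fin.cons ⟨a, ha⟩ fun i ↦ ⟨e i, Finset.mem_of_mem_erase (e i).2⟩
    have hf : Function.Bijective f := by
      rw [Fintype.bijective_iff_surjective_and_card]
      refine ⟨fun b ↦ ?_, by simp [Finset.card_erase_add_one ha]⟩
      by_cases hb : (b : X) = a
      · exact ⟨0, Subtype.ext hb.symm⟩
      · exact ⟨(e.symm ⟨b, Finset.mem_erase.2 ⟨hb, b.2⟩⟩).succ, by simp [f]⟩
    let v : K → I := fun b ↦ if h : (b : X) ∈ K.erase a then u ⟨b, h⟩ else 1
    have hpre : Finset.restrict₂ (π := fun _ ↦ I) (K.erase_subset a) ⁻¹' Iic u = Iic v := by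
      ext w
      simp only [mem_preimage, mem_Iic, Pi.le_def, Finset.restrict₂]
      refine ⟨fun h b ↦ ?_, fun h b ↦ ?_⟩
      · by_cases hb : (b : X) ∈ K.erase a
        · simpa only [v, dif_pos hb] using h ⟨b, hb⟩
        · simp only [v, dif_neg hb]
          exact (w b).2.2
      · simpa only [v, dif_pos b.2] using h ⟨b, Finset.mem_of_mem_erase b.2⟩
    rw [hpre, hμ.real_Iic _ (by omega) (Equiv.ofBijective f hf), hν.real_Iic _ hd e]
    have hv : v ∘ Equiv.ofBijective f hf = (0 : Fin _).insertNth (α := fun _ ↦ I) 1 (u ∘ e) := by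
      funext i
      refine Fin.cases ?_ (fun i ↦ ?_) i
      · simp [v, f]
      · have hi := (e i).2
        simp only [Function.comp_apply, Equiv.ofBijective_apply, f, Fin.cons_succ,
          Fin.insertNth_zero', v, dif_pos hi]
    rw [hv, hmarg _ hd]
    congr 2
  · obtain ⟨b, hb⟩ := Finset.card_eq_one.1 hd.symm
    have hbe : b ∈ K.erase a := by rw [hb]; exact Finset.mem_singleton_self b
    have hIic : Iic u = (fun w : K.erase a → I ↦ w ⟨b, hbe⟩) ⁻¹' Iic (u ⟨b, hbe⟩) := by
      ext w
      simp only [mem_Iic, mem_preimage, Pi.le_def]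
      refine ⟨fun h ↦ h _, fun h j ↦ ?_⟩
      obtain rfl : j = ⟨b, hbe⟩ := Subtype.ext (Finset.mem_singleton.1 (hb ▸ j.2))
      exact h
    rw [hIic, ← Measure.map_apply (by fun_prop) measurableSet_Iic,
      ← Measure.map_apply (by fun_prop) measurableSet_Iic,
      Measure.map_map (by fun_prop) hm, hν.map_eval]
    exact congrArg (· (Iic (u ⟨b, hbe⟩)))
      (hμ.map_eval ⟨b, Finset.mem_of_mem_erase hbe⟩).symm
  · have : IsEmpty (K.erase a) := Finset.isEmpty_coe_sort.2 (Finset.card_eq_zero.1 (by omega))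
    have hIic : Iic u = univ := eq_univ_of_forall fun w j ↦ isEmptyElim j
    rw [hIic, measure_univ, measure_univ]

theorem isProjectiveMeasureFamily_of_copula
    (hmarg : ∀ d, 1 < d → ∀ (x : Fin (d + 1) ↪ X) (k : Fin (d + 1)) (u : Fin d → I),
      ψ (d + 1) x (k.insertNth (α := fun _ => I) 1 u) =
        ψ d (k.succAboveEmb.trans x) u)
    {P : ∀ J : Finset X, Measure (J → I)} (hP : ∀ J, IsCopulaMeasure ψ J (P J)) :
    IsProjectiveMeasureFamily (α := fun _ ↦ I) P := by
  classical
  intro K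
  induction K using Finset.strongInduction with
  | H K ih =>
    intro J hJK
    rcases hJK.eq_or_ssubset with rfl | hlt
    · exact Measure.map_id.symm
    · obtain ⟨a, ha, haJ⟩ := Finset.exists_of_ssubset hlt
      rw [ih _ (Finset.erase_ssubset ha) J (Finset.subset_erase.2 ⟨hJK, haJ⟩),
        (hP K).map_restrict₂_erase hmarg ha (hP _),
        Measure.map_map (Finset.measurable_restrict₂ (X := fun _ ↦ I) _)
          (Finset.measurable_restrict₂ (X := fun _ ↦ I) _)]
      rfl

end Copula

/-! ### Quantile functions -/

/-- The quantile function of `μ`, as a map into `S`. The equivalence can fail only at the two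
endpoints and where the real quantile lies outside `S`. -/
theorem exists_quantile {S : Set ℝ} (hS : MeasurableSet S) (μ : Measure S)
    [IsProbabilityMeasure μ] :
    ∃ q : I → S, Measurable q ∧ ∀ t : ℝ, ∀ᵐ u : I, (q u : ℝ) ≤ t ↔ u ≤ distFun μ t := by
  have := Measure.isProbabilityMeasure_map (μ := μ) measurable_subtype_coe.aemeasurable
  set m : Measure ℝ := μ.map Subtype.val with hm
  have hF : ∀ t, (distFun μ t : ℝ) = ProbabilityTheory.cdf m t := fun t ↦ by
    rw [ProbabilityTheory.cdf_eq_real, hm,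
      map_measureReal_apply measurable_subtype_coe measurableSet_Iic]
    rfl
  have hgal : ∀ u ∈ Ioo (0 : ℝ) 1, ∀ t : ℝ,
      sInf {s | u ≤ ProbabilityTheory.cdf m s} ≤ t ↔ u ≤ ProbabilityTheory.cdf m t := by
    intro u hu t
    have hne : {s | u ≤ ProbabilityTheory.cdf m s}.Nonempty :=
      ((ProbabilityTheory.tendsto_cdf_atTop m).eventually (lt_mem_nhds hu.2)).exists.imp
        fun _ h ↦ h.le
    have hbdd : BddBelow {s | u ≤ ProbabilityTheory.cdf m s} := by
      obtain ⟨r, hr⟩ := ((ProbabilityTheory.tendsto_cdf_atBot m).eventually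
        (gt_mem_nhds hu.1)).exists
      refine ⟨r, fun s hs ↦ le_of_not_gt fun hsr ↦ ?_⟩
      exact absurd (hs.trans (ProbabilityTheory.monotone_cdf m hsr.le)) (not_le.2 hr)
    refine ⟨fun h ↦ ?_, fun h ↦ csInf_le hbdd h⟩
    -- right continuity: `u ≤ F s` for every `s > t`
    have hright : Tendsto (ProbabilityTheory.cdf m) (𝓝[>] t)
        (𝓝 (ProbabilityTheory.cdf m t)) :=
      ((ProbabilityTheory.cdf m).right_continuous t).mono_left
        (nhdsWithin_mono _ Ioi_subset_Ici_self)
    refine ge_of_tendsto hright (eventually_nhdsWithin_of_forall fun s hs ↦ ?_)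
    obtain ⟨r, hr, hrs⟩ := exists_lt_of_csInf_lt hne (h.trans_lt hs)
    exact hr.trans (ProbabilityTheory.monotone_cdf m hrs.le)
  -- the infimum is cut off at the endpoints, where its set may be empty or unbounded below
  let Q : I → ℝ := fun u ↦
    if (u : ℝ) ∈ Ioo (0 : ℝ) 1 then sInf {s | (u : ℝ) ≤ ProbabilityTheory.cdf m s} else 0
  have hIoo : MeasurableSet {u : I | (u : ℝ) ∈ Ioo (0 : ℝ) 1} :=
    measurable_subtype_coe measurableSet_Ioo
  have hQ : Measurable Q := by
    refine measurable_of_Iic fun t ↦ ?_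
    have : Q ⁻¹' Iic t = {u : I | (u : ℝ) ∈ Ioo (0 : ℝ) 1} ∩ Iic (distFun μ t) ∪
        {u : I | (u : ℝ) ∈ Ioo (0 : ℝ) 1}ᶜ ∩ {_u : I | (0 : ℝ) ≤ t} := by
      ext u
      change Q u ≤ t ↔ ((u : ℝ) ∈ Ioo (0 : ℝ) 1 ∧ u ≤ distFun μ t) ∨
        ((u : ℝ) ∉ Ioo (0 : ℝ) 1 ∧ (0 : ℝ) ≤ t)
      by_cases hu : (u : ℝ) ∈ Ioo (0 : ℝ) 1
      · have h := hgal u hu t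
        rw [← hF, Subtype.coe_le_coe] at h
        simp only [Q, if_pos hu, h, hu, true_and, not_true_eq_false, false_and, or_false]
      · simp only [Q, if_neg hu, hu, false_and, not_false_eq_true, true_and, false_or]
    rw [this]
    exact (hIoo.inter measurableSet_Iic).union (hIoo.compl.inter (.const _))
  have hae : ∀ᵐ u : I, (u : ℝ) ∈ Ioo (0 : ℝ) 1 := by
    filter_upwards [Measure.ae_ne volume (0 : I), Measure.ae_ne volume (1 : I)] with u h0 h1
    exact ⟨unitInterval.pos_iff_ne_zero.2 h0, unitInterval.lt_one_iff_ne_one.2 h1⟩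
  have hQle : ∀ t : ℝ, ∀ᵐ u : I, Q u ≤ t ↔ u ≤ distFun μ t := fun t ↦ by
    filter_upwards [hae] with u hu
    simp only [Q, if_pos hu, hgal u hu, ← Subtype.coe_le_coe, hF]
  have hlaw : (volume : Measure I).map Q = m := by
    refine Measure.ext_of_Iic _ _ fun t ↦ ?_
    rw [Measure.map_apply hQ measurableSet_Iic,
      measure_congr (t := Iic (distFun μ t)) (by filter_upwards [hQle t] with u hu using propext hu),
      unitInterval.volume_Iic, hF, ProbabilityTheory.ofReal_cdf]
  have hmem : ∀ᵐ u : I, Q u ∈ S := by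
    refine ae_of_ae_map hQ.aemeasurable ?_
    rw [hlaw]
    exact (ae_map_iff measurable_subtype_coe.aemeasurable hS).2 (ae_of_all _ fun s ↦ s.2)
  obtain ⟨s₀⟩ := nonempty_of_isProbabilityMeasure μ
  classical
  have hpatch : ∀ u, (if Q u ∈ S then Q u else (s₀ : ℝ)) ∈ S := fun u ↦ by
    split_ifs with h
    exacts [h, s₀.2]
  refine ⟨fun u ↦ ⟨_, hpatch u⟩,
    (Measurable.ite (hQ hS) hQ measurable_const).subtype_mk (h := hpatch), fun t ↦ ?_⟩
  filter_upwards [hmem, hQle t] with u hu ht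
  simpa only [if_pos hu] using ht

/-! ### Processes with prescribed copulas and marginals -/

theorem corollary1 {X : Type u} {S : Set ℝ} (hS : MeasurableSet S)
    (F : X → Measure S) [∀ x, IsProbabilityMeasure (F x)]
    (ψ : (d : ℕ) → (Fin d ↪ X) → (Fin d → I) → I)
    (hcop : ∀ d, 1 < d → ∀ x : Fin d ↪ X, IsCopula (ψ d x))
    (hperm : ∀ d, 1 < d → ∀ (x : Fin d ↪ X) (u : Fin d → I) (π : Equiv.Perm (Fin d)),
      ψ d x u = ψ d (π.toEmbedding.trans x) (fun i => u (π i)))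
    (hmarg : ∀ d, 1 < d → ∀ (x : Fin (d + 1) ↪ X) (k : Fin (d + 1)) (u : Fin d → I),
      ψ (d + 1) x (k.insertNth (α := fun _ => I) 1 u) =
        ψ d (k.succAboveEmb.trans x) u) :
    ∃ (Ω : Type u) (_ : MeasurableSpace Ω) (P : Measure Ω) (_ : IsProbabilityMeasure P)
      (Y : X → Ω → S),
      (∀ x, Measurable (Y x)) ∧
      (∀ (x : X) (t : ℝ), P.real {ω | (Y x ω : ℝ) ≤ t} = distFun (F x) t) ∧
      ∀ d, 1 < d → ∀ (x : Fin d ↪ X) (t : Fin d → ℝ),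
        P.real {ω | ∀ i, (Y (x i) ω : ℝ) ≤ t i} =
          ψ d x (fun i => distFun (F (x i)) (t i)) := by
  choose P hP using exists_isCopulaMeasure hcop hperm
  have := fun J ↦ (hP J).isProbabilityMeasure
  obtain ⟨μ, hμ⟩ := exists_isProjectiveLimit (isProjectiveMeasureFamily_of_copula hmarg hP)
  have := hμ.isProbabilityMeasure
  choose q hq hqle using fun x ↦ exists_quantile hS (F x)
  have heval : ∀ x : X, MeasurePreserving (fun ω : X → I ↦ ω x) μ volume := fun x ↦
    ⟨by fun_prop, by
      rw [← (hP {x}).map_eval ⟨x, Finset.mem_singleton_self x⟩, ← hμ {x},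
        Measure.map_map (by fun_prop) (by fun_prop)]
      rfl⟩
  have hle : ∀ (x : X) (t : ℝ), ∀ᵐ ω ∂μ, (q x (ω x) : ℝ) ≤ t ↔ ω x ≤ distFun (F x) t :=
    fun x t ↦ (heval x).quasiMeasurePreserving.ae (hqle x t)
  refine ⟨X → I, inferInstance, μ, inferInstance, fun x ω ↦ q x (ω x),
    fun x ↦ (hq x).comp (measurable_pi_apply x), fun x t ↦ ?_, fun d hd x t ↦ ?_⟩
  · rw [measureReal_congr (t := (fun ω : X → I ↦ ω x) ⁻¹' Iic (distFun (F x) t))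
      (by filter_upwards [hle x t] with ω hω using propext hω), measureReal_def,
      (heval x).measure_preimage measurableSet_Iic.nullMeasurableSet, unitInterval.volume_Iic,
      ENNReal.toReal_ofReal (distFun (F x) t).2.1]
  · let e : Fin d ≃ Finset.univ.map x := Equiv.ofBijective
      (fun i ↦ ⟨x i, Finset.mem_map_of_mem x (Finset.mem_univ i)⟩)
      ⟨fun i j h ↦ x.injective (congrArg Subtype.val h), fun ⟨y, hy⟩ ↦ by
        obtain ⟨i, -, rfl⟩ := Finset.mem_map.1 hy
        exact ⟨i, rfl⟩⟩
    let u : Finset.univ.map x → I := fun j ↦ distFun (F j) (t (e.symm j))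
    have hset : {ω : X → I | ∀ i, (q (x i) (ω (x i)) : ℝ) ≤ t i} =ᵐ[μ]
        (Finset.univ.map x).restrict ⁻¹' Iic u := by
      filter_upwards [ae_all_iff.2 fun i ↦ hle (x i) (t i)] with ω hω
      refine propext ((forall_congr' hω).trans ?_)
      refine (e.forall_congr fun i ↦ ?_)
      simp only [u, Equiv.symm_apply_apply]
      rfl
    rw [measureReal_congr hset, ← map_measureReal_apply (by fun_prop) measurableSet_Iic, hμ,
      (hP _).real_Iic d hd e]
    congr 2
    funext i
    simp only [u, Function.comp_apply, Equiv.symm_apply_apply]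
    rfl
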